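/- Model. An orchestrator and a client are joined by a fiber of length $l_{o,c}\ge 0$ and attenuation length $L_o>0$, with a beam splitter and photon-counting detectors at its mid-point. Each of them operates a transducer of the same efficiency $\eta\in[0,1]$, acting as a lossless beam splitter and producing the hybrid microwave-optical pure state $\sqrt{\eta}\,|0_M1_O\rangle+\sqrt{1-\eta}\,|1_M0_O\rangle$ (or, equivalently up to exchanging the two microwave levels, $\sqrt{\eta}\,|1_M1_O\rangle+\sqrt{1-\eta}\,|0_M0_O\rangle$); the two transducers are independent. A photon travelling through a fiber of length $x$ survives, independently of everything else, with probability $e^{-x/L_o}$. A distribution attempt (TMD with intrinsic entanglement generated at both orchestrator and client, followed by mid-point swapping) succeeds if exactly one transducer emits an optical photon and this photon reaches the mid-point. The ebit distribution probability $p^{IES}_c$ is the entanglement of distillation of the hybrid state produced by a transducer, i.e. the von Neumann entropy $-\mathrm{Tr}(\rho_A\log_2\rho_A)$ of its reduced state $\rho_A$, times the probability that the attempt succeeds. Lemma (IES-TMD: ebit distribution probability). Let $S(\eta)=-\eta\log_2\eta-(1-\eta)\log_2(1-\eta)$, with $0\log_2 0=0$. The entanglement of distillation of the hybrid state equals $S(\eta)$.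 Each transducer emits an optical photon with probability $\eta$, the two emissions are independent, and the probability that exactly one of the two transducers emits is $2(\eta-\eta^2)$. Moreover $$p^{IES}_c = S(\eta)\cdot 2(\eta-\eta^2)\, e^{-\frac{l_{o,c}}{2L_o}}.$$ For every fixed $l_{o,c}$ and $L_o$, the maximum of $p^{IES}_c$ over $\eta\in[0,1]$ is attained at $\eta=1/2$ and only there; when fiber loss is neglected ($l_{o,c}=0$) this maximum equals $1/2$. -/

import Mathlib

open MeasureTheory

namespace IESTMD

/-- A Fock occupation number restricted to the vacuum and the one-photon level. -/
abbrev Occ : Type := Fin 2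

/-- A (microwave, optical) configuration of the two modes of one transducer. -/
abbrev Modes : Type := Occ × Occ

/-- The two equivalent ways of operating the transducer as an intrinsic entanglement source:
`red` starts from one microwave photon (which may be up-converted), `blue` starts from the
vacuum (a microwave-optical photon pair may be created). -/
inductive Detuning
  | red
  | blue

/-- The hybrid microwave-optical pure state produced by a lossless transducer of efficiency `η`,
as amplitudes in the Fock basis `|microwave, optical⟩`:
`√η |0,1⟩ + √(1-η) |1,0⟩` for `red`, and the same state with the two microwave levels
exchanged, `√η |1,1⟩ + √(1-η) |0,0⟩`, for `blue`. -/
noncomputable def hybridKet : Detuning → ℝ → Modes → ℂ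
  | .red, η, (0, 1) => (Real.sqrt η : ℂ)
  | .red, η, (1, 0) => (Real.sqrt (1 - η) : ℂ)
  | .blue, η, (1, 1) => (Real.sqrt η : ℂ)
  | .blue, η, (0, 0) => (Real.sqrt (1 - η) : ℂ)
  | _, _, _ => 0

/-- Reduced density matrix on the microwave mode: the partial trace over the optical mode of
`|ψ⟩⟨ψ|`. -/
noncomputable def reducedDensity (ψ : Modes → ℂ) : Matrix Occ Occ ℂ :=
  Matrix.of fun i j => ∑ k : Occ, ψ (i, k) * star (ψ (j, k))

theorem reducedDensity_isHermitian (ψ : Modes → ℂ) : (reducedDensity ψ).IsHermitian := by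
  ext i j
  simp [reducedDensity, Matrix.conjTranspose_apply, mul_comm]

/-- Von Neumann entropy `-Tr (ρ log₂ ρ)`, evaluated on the eigenvalues of `ρ`. -/
noncomputable def vonNeumannEntropy (ρ : Matrix Occ Occ ℂ) (hρ : ρ.IsHermitian) : ℝ :=
  ∑ i, -(hρ.eigenvalues i * Real.logb 2 (hρ.eigenvalues i))

/-- Entanglement of distillation (in ebits) of a pure bipartite state: the von Neumann entropy of
its reduced state. -/
noncomputable def distillableEntanglement (ψ : Modes → ℂ) : ℝ :=
  vonNeumannEntropy (reducedDensity ψ) (reducedDensity_isHermitian ψ)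

/-- The entropy `S(η)` as a function of the eigenvalue `η`. -/
noncomputable def S (η : ℝ) : ℝ :=
  -η * Real.logb 2 η - (1 - η) * Real.logb 2 (1 - η)

/-- Born rule in the Fock basis. -/
noncomputable def bornMeasure {ι : Type} [Fintype ι] [MeasurableSpace ι] (ψ : ι → ℂ) : Measure ι :=
  ∑ i, ENNReal.ofReal (‖ψ i‖ ^ 2) • Measure.dirac i

/-- Joint state of the separate transducers of the orchestrator and of the client. -/
noncomputable def jointKet (ψo ψc : Modes → ℂ) : Modes × Modes → ℂ :=
  fun x => ψo x.1 * ψc x.2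

/-- Joint law of the numbers of optical photons emitted by the orchestrator and by the client, both
of whose transducers have efficiency `η`. -/
noncomputable def emissionLaw (d : Detuning) (η : ℝ) : Measure (Occ × Occ) :=
  (bornMeasure (jointKet (hybridKet d η) (hybridKet d η))).map fun x => (x.1.2, x.2.2)

/-- The absorbing channel given by a fiber of length `x` and attenuation length `L₀`: the photon
gets through (`true`) with probability `exp (-x / L₀)` and is absorbed (`false`) otherwise. -/
noncomputable def fiberLaw (x L₀ : ℝ) : Measure Bool :=
  ENNReal.ofReal (Real.exp (-x / L₀)) • Measure.dirac true +
    ENNReal.ofReal (1 - Real.exp (-x / L₀)) • Measure.dirac false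

/-- One distribution attempt over a link of length `l` with beam splitter and photon counters at
its mid-point. An outcome consists of the emitted optical photon numbers (orchestrator, client) and
of the behaviours of the two half-links, each of length `l / 2`; the half-links act independently of
each other and of the emissions. -/
noncomputable def attemptLaw (d : Detuning) (η l L₀ : ℝ) :
    Measure ((Occ × Occ) × (Bool × Bool)) :=
  (emissionLaw d η).prod ((fiberLaw (l / 2) L₀).prod (fiberLaw (l / 2) L₀))

/-- Exactly one of the two transducers emits an optical photon. -/
def exactlyOne : Set (Occ × Occ) := {e | (e.1 : ℕ) + (e.2 : ℕ) = 1}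

/-- Number of optical photons that reach the mid-point. -/
def arrived (ω : (Occ × Occ) × (Bool × Bool)) : ℕ :=
  (if ω.2.1 then (ω.1.1 : ℕ) else 0) + (if ω.2.2 then (ω.1.2 : ℕ) else 0)

/-- Successful swapping: exactly one of the transducers has emitted an optical photon, and this
photon is counted at the mid-point. -/
def swapSuccess : Set ((Occ × Occ) × (Bool × Bool)) :=
  {ω | ω.1 ∈ exactlyOne ∧ arrived ω = 1}

/-- The ebit distribution probability between the orchestrator and a client at distance `l`:
the entanglement generation probability of the transducers, quantified by the entanglement of
distillation of the hybrid pair, times the probability of successful swapping. -/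
noncomputable def ebitProb (d : Detuning) (η l L₀ : ℝ) : ℝ :=
  distillableEntanglement (hybridKet d η) * (attemptLaw d η l L₀).real swapSuccess

end IESTMD

/-!
The Fock amplitudes of each hybrid state form a matrix with at most one non-zero entry in each row
and each column, so the reduced microwave state is diagonal with entries `η` and `1 - η` in some
order (`exists_reducedDensity_hybridKet`). The eigenvalues of a Hermitian matrix are, with
multiplicity, the roots of its characteristic polynomial, hence the diagonal entries here, and the
von Neumann entropy is `S η`.

The Born measure of a product state is a product measure (`bornMeasure_jointKet`), and projecting
each factor to its optical mode gives the Bernoulli law of parameter `η`. The law of the emissions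
is therefore a product of two such Bernoulli laws, and a successful attempt is the disjoint union of
two rectangles, one for each choice of the transducer that emits; each has probability
`η (1 - η) exp (-l / (2 L₀))`.

For the maximum, `S` is the binary entropy in bits, which is at most `1` with equality only at
`1 / 2`, and `2 (η - η²) = 1 / 2 - 2 (η - 1 / 2)²` is at most `1 / 2`; both factors are nonnegative
on `[0, 1]`.
-/

namespace IESTMD

/-! ### Entanglement of distillation -/

theorem vonNeumannEntropy_of_eq_diagonal {ρ : Matrix Occ Occ ℂ} (hρ : ρ.IsHermitian)
    (p : Occ → ℝ) (h : ρ = Matrix.diagonal fun i => (p i : ℂ)) :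
    vonNeumannEntropy ρ hρ = ∑ i, -(p i * Real.logb 2 (p i)) := by
  -- The eigenvalues are listed in decreasing order, so they agree with `p` only as a multiset.
  have hroots := hρ.roots_charpoly_eq_eigenvalues
  have hdiag : ρ.charpoly.roots = Finset.univ.val.map fun i => (p i : ℂ) := by
    rw [h, Matrix.charpoly_diagonal, Polynomial.roots_prod]
    · simp
    · simp [Polynomial.X_sub_C_ne_zero]
  have hmul : Finset.univ.val.map hρ.eigenvalues = Finset.univ.val.map p := by
    have := congrArg (Multiset.map Complex.re) (hroots.symm.trans hdiag)
    simpa only [Multiset.map_map, Function.comp_def, Complex.coe_algebraMap, Complex.ofReal_re,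
      RCLike.ofReal_eq_complex_ofReal, Complex.ofReal_re] using this
  have := congrArg (fun m : Multiset ℝ => (m.map fun x => -(x * Real.logb 2 x)).sum) hmul
  simpa only [Multiset.map_map, Function.comp_def, vonNeumannEntropy, Finset.sum] using this

/-- The order of the two populations on the diagonal depends on the detuning. -/
theorem exists_reducedDensity_hybridKet (d : Detuning) {η : ℝ} (hη : η ∈ Set.Icc (0 : ℝ) 1) :
    ∃ p : Occ → ℝ, reducedDensity (hybridKet d η) = Matrix.diagonal (fun i => (p i : ℂ)) ∧
      (p = ![η, 1 - η] ∨ p = ![1 - η, η]) := by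
  have h1 : (Real.sqrt η : ℂ) * Real.sqrt η = η := by
    rw [← Complex.ofReal_mul, Real.mul_self_sqrt hη.1]
  have h2 : (Real.sqrt (1 - η) : ℂ) * Real.sqrt (1 - η) = 1 - η := by
    rw [← Complex.ofReal_mul, Real.mul_self_sqrt (sub_nonneg.2 hη.2)]
    push_cast
    rfl
  cases d
  · refine ⟨![η, 1 - η], ?_, .inl rfl⟩
    ext i j
    fin_cases i <;> fin_cases j <;> simp [reducedDensity, hybridKet, h1, h2]
  · refine ⟨![1 - η, η], ?_, .inr rfl⟩
    ext i j
    fin_cases i <;> fin_cases j <;> simp [reducedDensity, hybridKet, h1, h2]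

theorem distillableEntanglement_hybridKet (d : Detuning) {η : ℝ} (hη : η ∈ Set.Icc (0 : ℝ) 1) :
    distillableEntanglement (hybridKet d η) = S η := by
  obtain ⟨p, hp, hp'⟩ := exists_reducedDensity_hybridKet d hη
  rw [distillableEntanglement, vonNeumannEntropy_of_eq_diagonal _ p hp, Fin.sum_univ_two, S]
  rcases hp' with rfl | rfl <;> simp <;> ring

/-! ### Emission of optical photons -/

instance {ι : Type} [Fintype ι] [MeasurableSpace ι] (ψ : ι → ℂ) :
    IsFiniteMeasure (bornMeasure ψ) := by
  refine ⟨?_⟩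
  simp [bornMeasure, ENNReal.sum_lt_top]

theorem bornMeasure_singleton {ι : Type} [Fintype ι] [MeasurableSpace ι]
    [MeasurableSingletonClass ι] (ψ : ι → ℂ) (i : ι) :
    bornMeasure ψ {i} = ENNReal.ofReal (‖ψ i‖ ^ 2) := by
  classical
  simp [bornMeasure, Measure.finsetSum_apply, Set.indicator_apply]

theorem bornMeasure_jointKet (ψ φ : Modes → ℂ) :
    bornMeasure (jointKet ψ φ) = (bornMeasure ψ).prod (bornMeasure φ) := by
  refine Measure.ext_of_singleton fun ⟨a, b⟩ => ?_
  rw [← Set.singleton_prod_singleton, Measure.prod_prod, Set.singleton_prod_singleton,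
    bornMeasure_singleton, bornMeasure_singleton, bornMeasure_singleton, jointKet, norm_mul,
    mul_pow, ENNReal.ofReal_mul (by positivity)]

/-- Law of the number of optical photons emitted by a single transducer. -/
noncomputable def photonLaw (d : Detuning) (η : ℝ) : Measure Occ :=
  (bornMeasure (hybridKet d η)).map Prod.snd

instance (d : Detuning) (η : ℝ) : IsFiniteMeasure (photonLaw d η) := by
  unfold photonLaw
  infer_instance

theorem photonLaw_eq (d : Detuning) {η : ℝ} (hη : η ∈ Set.Icc (0 : ℝ) 1) :
    photonLaw d η = ENNReal.ofReal η • Measure.dirac 1 +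
      ENNReal.ofReal (1 - η) • Measure.dirac 0 := by
  have hsq {x : ℝ} (hx : 0 ≤ x) : ‖(Real.sqrt x : ℂ)‖ₑ ^ 2 = ENNReal.ofReal x := by
    rw [← ofReal_norm, Complex.norm_real, ← ENNReal.ofReal_pow (norm_nonneg _),
      Real.norm_eq_abs, sq_abs, Real.sq_sqrt hx]
  refine Measure.ext_of_singleton fun i => ?_
  rw [photonLaw, Measure.map_apply measurable_snd (measurableSet_singleton i)]
  cases d <;> fin_cases i <;>
    simp [bornMeasure, Fintype.sum_prod_type, Fin.sum_univ_two, hybridKet, hsq hη.1,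
      hsq (sub_nonneg.2 hη.2)]

theorem isProbabilityMeasure_photonLaw (d : Detuning) {η : ℝ} (hη : η ∈ Set.Icc (0 : ℝ) 1) :
    IsProbabilityMeasure (photonLaw d η) := by
  refine ⟨?_⟩
  rw [photonLaw_eq d hη]
  simp [← ENNReal.ofReal_add hη.1 (sub_nonneg.2 hη.2)]

theorem photonLaw_real_one (d : Detuning) {η : ℝ} (hη : η ∈ Set.Icc (0 : ℝ) 1) :
    (photonLaw d η).real {1} = η := by
  rw [Measure.real, photonLaw_eq d hη]
  simp [hη.1]

theorem photonLaw_real_zero (d : Detuning) {η : ℝ} (hη : η ∈ Set.Icc (0 : ℝ) 1) :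
    (photonLaw d η).real {0} = 1 - η := by
  rw [Measure.real, photonLaw_eq d hη]
  simp [hη.2]

theorem emissionLaw_eq_prod (d : Detuning) (η : ℝ) :
    emissionLaw d η = (photonLaw d η).prod (photonLaw d η) := by
  rw [emissionLaw, bornMeasure_jointKet, photonLaw,
    Measure.map_prod_map _ _ measurable_snd measurable_snd]
  rfl

theorem emissionLaw_real_fst (d : Detuning) {η : ℝ} (hη : η ∈ Set.Icc (0 : ℝ) 1) :
    (emissionLaw d η).real {e | e.1 = 1} = η := by
  have := isProbabilityMeasure_photonLaw d hη
  have h : {e : Occ × Occ | e.1 = 1} = {1} ×ˢ Set.univ := by ext; simp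
  rw [emissionLaw_eq_prod, h, measureReal_prod_prod, photonLaw_real_one d hη]
  simp

theorem emissionLaw_real_snd (d : Detuning) {η : ℝ} (hη : η ∈ Set.Icc (0 : ℝ) 1) :
    (emissionLaw d η).real {e | e.2 = 1} = η := by
  have := isProbabilityMeasure_photonLaw d hη
  have h : {e : Occ × Occ | e.2 = 1} = Set.univ ×ˢ {1} := by ext; simp
  rw [emissionLaw_eq_prod, h, measureReal_prod_prod, photonLaw_real_one d hη]
  simp

theorem indepFun_emissionLaw (d : Detuning) {η : ℝ} (hη : η ∈ Set.Icc (0 : ℝ) 1) :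
    ProbabilityTheory.IndepFun Prod.fst Prod.snd (emissionLaw d η) := by
  have := isProbabilityMeasure_photonLaw d hη
  rw [emissionLaw_eq_prod]
  exact ProbabilityTheory.indepFun_prod measurable_id measurable_id

theorem exactlyOne_eq : exactlyOne = {(1, 0)} ∪ {(0, 1)} := by
  ext ⟨a, b⟩
  fin_cases a <;> fin_cases b <;> simp [exactlyOne]

theorem emissionLaw_real_one_zero (d : Detuning) {η : ℝ} (hη : η ∈ Set.Icc (0 : ℝ) 1) :
    (emissionLaw d η).real {(1, 0)} = η * (1 - η) := by
  rw [emissionLaw_eq_prod, ← Set.singleton_prod_singleton, measureReal_prod_prod,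
    photonLaw_real_one d hη, photonLaw_real_zero d hη]

theorem emissionLaw_real_zero_one (d : Detuning) {η : ℝ} (hη : η ∈ Set.Icc (0 : ℝ) 1) :
    (emissionLaw d η).real {(0, 1)} = (1 - η) * η := by
  rw [emissionLaw_eq_prod, ← Set.singleton_prod_singleton, measureReal_prod_prod,
    photonLaw_real_one d hη, photonLaw_real_zero d hη]

theorem isProbabilityMeasure_emissionLaw (d : Detuning) {η : ℝ} (hη : η ∈ Set.Icc (0 : ℝ) 1) :
    IsProbabilityMeasure (emissionLaw d η) := by
  have := isProbabilityMeasure_photonLaw d hη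
  rw [emissionLaw_eq_prod]
  infer_instance

theorem emissionLaw_real_exactlyOne (d : Detuning) {η : ℝ} (hη : η ∈ Set.Icc (0 : ℝ) 1) :
    (emissionLaw d η).real exactlyOne = 2 * (η - η ^ 2) := by
  have := isProbabilityMeasure_emissionLaw d hη
  rw [exactlyOne_eq, measureReal_union (by simp) (measurableSet_singleton _),
    emissionLaw_real_one_zero d hη, emissionLaw_real_zero_one d hη]
  ring

/-! ### Transmission to the mid-point and swapping -/

theorem isProbabilityMeasure_fiberLaw {x L₀ : ℝ} (hx : 0 ≤ x) (hL₀ : 0 < L₀) :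
    IsProbabilityMeasure (fiberLaw x L₀) := by
  have h : Real.exp (-x / L₀) ≤ 1 :=
    Real.exp_le_one_iff.2 (div_nonpos_of_nonpos_of_nonneg (neg_nonpos.2 hx) hL₀.le)
  refine ⟨?_⟩
  simp [fiberLaw, ← ENNReal.ofReal_add (Real.exp_pos _).le (sub_nonneg.2 h)]

theorem fiberLaw_real_true (x L₀ : ℝ) : (fiberLaw x L₀).real {true} = Real.exp (-x / L₀) := by
  simp [Measure.real, fiberLaw, (Real.exp_pos _).le]

theorem isProbabilityMeasure_attemptLaw (d : Detuning) {η l L₀ : ℝ} (hη : η ∈ Set.Icc (0 : ℝ) 1)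
    (hl : 0 ≤ l) (hL₀ : 0 < L₀) : IsProbabilityMeasure (attemptLaw d η l L₀) := by
  have := isProbabilityMeasure_emissionLaw d hη
  have := isProbabilityMeasure_fiberLaw (div_nonneg hl zero_le_two) hL₀
  unfold attemptLaw
  infer_instance

theorem swapSuccess_eq :
    swapSuccess = {(1, 0)} ×ˢ ({true} ×ˢ Set.univ) ∪ {(0, 1)} ×ˢ (Set.univ ×ˢ {true}) := by
  ext ⟨⟨a, b⟩, s, t⟩
  fin_cases a <;> fin_cases b <;> cases s <;> cases t <;>
    simp [swapSuccess, exactlyOne, arrived]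

theorem attemptLaw_real_swapSuccess (d : Detuning) {η l L₀ : ℝ} (hη : η ∈ Set.Icc (0 : ℝ) 1)
    (hl : 0 ≤ l) (hL₀ : 0 < L₀) :
    (attemptLaw d η l L₀).real swapSuccess =
      2 * (η - η ^ 2) * Real.exp (-l / (2 * L₀)) := by
  have := isProbabilityMeasure_emissionLaw d hη
  have := isProbabilityMeasure_fiberLaw (div_nonneg hl zero_le_two) hL₀
  have := isProbabilityMeasure_attemptLaw d hη hl hL₀
  have hdisj : Disjoint (({(1, 0)} : Set (Occ × Occ)) ×ˢ (({true} : Set Bool) ×ˢ Set.univ))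
      ({(0, 1)} ×ˢ ((Set.univ : Set Bool) ×ˢ {true})) :=
    Set.disjoint_prod.2 (.inl (by simp))
  rw [swapSuccess_eq, measureReal_union hdisj (.of_discrete)]
  simp only [attemptLaw, measureReal_prod_prod, emissionLaw_real_one_zero d hη,
    emissionLaw_real_zero_one d hη, fiberLaw_real_true, probReal_univ]
  rw [show -(l / 2) / L₀ = -l / (2 * L₀) by ring]
  ring

/-! ### Maximum over the efficiency -/

theorem S_eq_binEntropy (η : ℝ) : S η = Real.binEntropy η / Real.log 2 := by
  rw [S, Real.binEntropy_eq_negMulLog_add_negMulLog_one_sub, Real.negMulLog, Real.negMulLog,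
    Real.logb, Real.logb]
  ring

theorem S_half : S (1 / 2) = 1 := by
  rw [S_eq_binEntropy, one_div, Real.binEntropy_two_inv, div_self (Real.log_pos one_lt_two).ne']

theorem S_lt_one {η : ℝ} (h : η ≠ 1 / 2) : S η < 1 := by
  rw [S_eq_binEntropy, div_lt_one (Real.log_pos one_lt_two), Real.binEntropy_lt_log_two]
  rwa [one_div] at h

theorem S_mul_exactlyOne_lt {η : ℝ} (hη : η ∈ Set.Icc (0 : ℝ) 1) (h : η ≠ 1 / 2) :
    S η * (2 * (η - η ^ 2)) < 1 / 2 := by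
  have hpos : 0 < (η - 1 / 2) ^ 2 := sq_pos_of_ne_zero (sub_ne_zero.2 h)
  have hnn : 0 ≤ η * (1 - η) := mul_nonneg hη.1 (sub_nonneg.2 hη.2)
  calc S η * (2 * (η - η ^ 2)) ≤ 1 * (2 * (η - η ^ 2)) :=
        mul_le_mul_of_nonneg_right (S_lt_one h).le (by linarith)
    _ < 1 / 2 := by linarith

theorem ebitProb_eq (d : Detuning) {η l L₀ : ℝ} (hη : η ∈ Set.Icc (0 : ℝ) 1) (hl : 0 ≤ l)
    (hL₀ : 0 < L₀) :
    ebitProb d η l L₀ = S η * (2 * (η - η ^ 2)) * Real.exp (-l / (2 * L₀)) := by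
  rw [ebitProb, distillableEntanglement_hybridKet d hη, attemptLaw_real_swapSuccess d hη hl hL₀]
  ring

theorem ebitProb_half (d : Detuning) {l L₀ : ℝ} (hl : 0 ≤ l) (hL₀ : 0 < L₀) :
    ebitProb d (1 / 2) l L₀ = 1 / 2 * Real.exp (-l / (2 * L₀)) := by
  rw [ebitProb_eq d (by norm_num) hl hL₀, S_half]
  norm_num

theorem ebitProb_lt_ebitProb_half (d : Detuning) {η l L₀ : ℝ} (hη : η ∈ Set.Icc (0 : ℝ) 1)
    (hl : 0 ≤ l) (hL₀ : 0 < L₀) (h : η ≠ 1 / 2) :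
    ebitProb d η l L₀ < ebitProb d (1 / 2) l L₀ := by
  rw [ebitProb_half d hl hL₀, ebitProb_eq d hη hl hL₀]
  exact mul_lt_mul_of_pos_right (S_mul_exactlyOne_lt hη h) (Real.exp_pos _)

theorem ebitProb_le_ebitProb_half (d : Detuning) {η l L₀ : ℝ} (hη : η ∈ Set.Icc (0 : ℝ) 1)
    (hl : 0 ≤ l) (hL₀ : 0 < L₀) : ebitProb d η l L₀ ≤ ebitProb d (1 / 2) l L₀ := by
  rcases eq_or_ne η (1 / 2) with rfl | h
  · exact le_rfl
  · exact (ebitProb_lt_ebitProb_half d hη hl hL₀ h).le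

end IESTMD

theorem lemma5 (d : IESTMD.Detuning) (L₀ : ℝ) (hL₀ : 0 < L₀) :
    -- for every efficiency and every length of the fiber link
    (∀ η ∈ Set.Icc (0 : ℝ) 1, ∀ l : ℝ, 0 ≤ l →
      -- the two laws are probability laws, and the two emissions are independent, each of
      -- probability `η`
      IsProbabilityMeasure (IESTMD.attemptLaw d η l L₀) ∧
      IsProbabilityMeasure (IESTMD.emissionLaw d η) ∧
      (IESTMD.emissionLaw d η).real {e | e.1 = 1} = η ∧
      (IESTMD.emissionLaw d η).real {e | e.2 = 1} = η ∧
      ProbabilityTheory.IndepFun Prod.fst Prod.snd (IESTMD.emissionLaw d η) ∧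
      -- `S η` is the entanglement of distillation of each hybrid pair
      IESTMD.distillableEntanglement (IESTMD.hybridKet d η) = IESTMD.S η ∧
      -- the probability that exactly one transducer emits an optical photon
      (IESTMD.emissionLaw d η).real IESTMD.exactlyOne = 2 * (η - η ^ 2) ∧
      -- the ebit distribution probability
      IESTMD.ebitProb d η l L₀ =
        IESTMD.S η * (2 * (η - η ^ 2)) * Real.exp (-l / (2 * L₀)) ∧
      -- its maximum over `η` is attained at `1 / 2`, and only there
      IESTMD.ebitProb d η l L₀ ≤ IESTMD.ebitProb d (1 / 2) l L₀ ∧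
      (IESTMD.ebitProb d η l L₀ = IESTMD.ebitProb d (1 / 2) l L₀ ↔ η = 1 / 2)) ∧
    -- without fiber loss the maximum equals `1 / 2`
    IESTMD.ebitProb d (1 / 2) 0 L₀ = 1 / 2 ∧
    IsGreatest ((fun η => IESTMD.ebitProb d η 0 L₀) '' Set.Icc (0 : ℝ) 1) (1 / 2) := by
  have hlossless : IESTMD.ebitProb d (1 / 2) 0 L₀ = 1 / 2 := by
    rw [IESTMD.ebitProb_half d le_rfl hL₀]
    simp
  refine ⟨fun η hη l hl => ⟨IESTMD.isProbabilityMeasure_attemptLaw d hη hl hL₀,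
    IESTMD.isProbabilityMeasure_emissionLaw d hη, IESTMD.emissionLaw_real_fst d hη,
    IESTMD.emissionLaw_real_snd d hη, IESTMD.indepFun_emissionLaw d hη,
    IESTMD.distillableEntanglement_hybridKet d hη, IESTMD.emissionLaw_real_exactlyOne d hη,
    IESTMD.ebitProb_eq d hη hl hL₀, IESTMD.ebitProb_le_ebitProb_half d hη hl hL₀, ?_⟩,
    hlossless, ⟨1 / 2, by norm_num, hlossless⟩, ?_⟩
  · refine ⟨fun h => ?_, fun h => by rw [h]⟩
    by_contra hne
    exact (IESTMD.ebitProb_lt_ebitProb_half d hη hl hL₀ hne).ne h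
  · rintro _ ⟨η, hη, rfl⟩
    exact (IESTMD.ebitProb_le_ebitProb_half d hη le_rfl hL₀).trans_eq hlossless
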